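/- For $n\in\mathbb N_0$ let $L_n=(\mathbb C^2)^{\otimes_S n}\subseteq(\mathbb C^2)^{\otimes n}$ be the Hilbert space of symmetric tensors (with $L_0=\mathbb C$), and let $\rho_n:SU(2)\to U(L_n)$ be the restriction of the $n$-fold tensor power of the fundamental representation of $SU(2)$ on $\mathbb C^2$. For a unitary representation $\tau:SU(2)\to U(H)$ on a finite-dimensional complex Hilbert space put $$\det(\tau,H)=\{\xi\in H\otimes H \mid (\tau(g)\otimes\tau(g))\xi=\xi\ \text{ for all } g\in SU(2)\}.$$ Let $\tau:SU(2)\to U(H)$ be a strongly continuous unitary representation on a finite-dimensional Hilbert space $H$, let $k_m\in\mathbb N_0$ for $m\in\mathbb N_0$, and let $V:\bigoplus_{m=0}^\infty L_m^{\oplus k_m}\to H$ be a unitary operator intertwining $\bigoplus_{m=0}^\infty\rho_m^{\oplus k_m}$ and $\tau$ (so that $k_m=0$ for all but finitely many $m$). Then $\det(\tau,H)\subseteq H\otimes H$ has dimension $\sum_{m=0}^\infty k_m^2$. Moreover the isometry $$\bigoplus_{m=0}^\infty(L_m\otimes L_m)^{\oplus k_m^2}\;\cong\;\bigoplus_{m=0}^\infty\bigl(L_m^{\oplus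 k_m}\otimes L_m^{\oplus k_m}\bigr)\xrightarrow{\ \iota\ }H\otimes H,$$ where the first map is the canonical unitary identification (the $k_m^2$ copies being indexed by pairs $(i,j)$ with $1\le i,j\le k_m$) and $\iota$ is given in degree $m$ by $\iota(\xi_m\otimes\eta_m)=V(\xi_m\delta_m)\otimes V(\eta_m\delta_m)$, with $\xi_m\delta_m$ denoting the vector $\xi_m\in L_m^{\oplus k_m}$ placed in the $m$-th summand, restricts to a unitary isomorphism from the subspace $$\bigoplus_{m=0}^\infty\det(\rho_m,L_m)^{\oplus k_m^2}\subseteq\bigoplus_{m=0}^\infty(L_m\otimes L_m)^{\oplus k_m^2}$$ onto $\det(\tau,H)$. -/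

import Mathlib

open scoped TensorProduct InnerProductSpace

noncomputable section

namespace SU2Det

/-- The group `SU(2)`, with the topology of a subspace of the complex `2 × 2` matrices. -/
abbrev SU2 : Type := Matrix.specialUnitaryGroup (Fin 2) ℂ

/-- The Hilbert space `ℂ²`. -/
abbrev C2 : Type := EuclideanSpace ℂ (Fin 2)

/-! ### The Hilbert space `(ℂ²)^{⊗ n}` -/

/-- The tensor power `(ℂ²)^{⊗ n}`. (A type synonym, since Mathlib equips `PiTensorProduct` itself
with the projective norm instead of the Hilbert space norm.) -/
def TensorPow (n : ℕ) : Type := ⨂[ℂ] _ : Fin n, C2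

instance (n : ℕ) : AddCommGroup (TensorPow n) :=
  inferInstanceAs (AddCommGroup (⨂[ℂ] _ : Fin n, C2))

instance (n : ℕ) : Module ℂ (TensorPow n) :=
  inferInstanceAs (Module ℂ (⨂[ℂ] _ : Fin n, C2))

/-- The elementary tensor `x₁ ⊗ ⋯ ⊗ xₙ`. -/
def TensorPow.tprod {n : ℕ} (x : Fin n → C2) : TensorPow n := PiTensorProduct.tprod ℂ x

/-- The basis `f_{p 1} ⊗ ⋯ ⊗ f_{p n}` of `(ℂ²)^{⊗ n}`, where `f₀, f₁` is the standard basis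
of `ℂ²`. -/
def TensorPow.basis (n : ℕ) : Module.Basis (Fin n → Fin 2) ℂ (TensorPow n) :=
  Basis.piTensorProduct fun _ : Fin n => (EuclideanSpace.basisFun (Fin 2) ℂ).toBasis

/-- The coordinates with respect to `TensorPow.basis`. -/
def TensorPow.coords (n : ℕ) : TensorPow n ≃ₗ[ℂ] EuclideanSpace ℂ (Fin n → Fin 2) :=
  (TensorPow.basis n).equivFun ≪≫ₗ (WithLp.linearEquiv 2 ℂ ((Fin n → Fin 2) → ℂ)).symm

/-- The norm for which `TensorPow.basis` is orthonormal. -/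
instance (n : ℕ) : NormedAddCommGroup (TensorPow n) :=
  NormedAddCommGroup.induced _ _ (TensorPow.coords n) (TensorPow.coords n).injective

/-- The inner product for which `TensorPow.basis` is orthonormal; by `TensorPow.inner_tprod` it is
the usual one. -/
instance (n : ℕ) : InnerProductSpace ℂ (TensorPow n) :=
  InnerProductSpace.induced (TensorPow.coords n)

theorem TensorPow.inner_def {n : ℕ} (x y : TensorPow n) :
    ⟪x, y⟫_ℂ = ⟪TensorPow.coords n x, TensorPow.coords n y⟫_ℂ := rfl

theorem TensorPow.coords_tprod {n : ℕ} (x : Fin n → C2) (p : Fin n → Fin 2) :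
    TensorPow.coords n (TensorPow.tprod x) p = ∏ i, x i (p i) := by
  have h := Basis.piTensorProduct_repr_tprod_apply
    (fun _ : Fin n => (EuclideanSpace.basisFun (Fin 2) ℂ).toBasis) x p
  rw [show TensorPow.coords n (TensorPow.tprod x) p
    = (Basis.piTensorProduct fun _ : Fin n => (EuclideanSpace.basisFun (Fin 2) ℂ).toBasis).repr
      (PiTensorProduct.tprod ℂ x) p from rfl, h]
  simp

/-- `⟪x₁ ⊗ ⋯ ⊗ xₙ, y₁ ⊗ ⋯ ⊗ yₙ⟫ = ∏ i, ⟪xᵢ, yᵢ⟫`. -/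
theorem TensorPow.inner_tprod {n : ℕ} (x y : Fin n → C2) :
    ⟪TensorPow.tprod x, TensorPow.tprod y⟫_ℂ = ∏ i, ⟪x i, y i⟫_ℂ := by
  rw [TensorPow.inner_def]
  simp only [PiLp.inner_apply, TensorPow.coords_tprod]
  rw [Finset.prod_univ_sum]
  simp [Finset.prod_mul_distrib]

theorem TensorPow.span_tprod (n : ℕ) :
    Submodule.span ℂ (Set.range (TensorPow.tprod (n := n))) = ⊤ :=
  PiTensorProduct.span_tprod_eq_top

/-- The operator `e ⊗ ⋯ ⊗ e` on `(ℂ²)^{⊗ n}` for an invertible operator `e` on `ℂ²`. -/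
def TensorPow.congr (n : ℕ) (e : C2 ≃ₗ[ℂ] C2) : TensorPow n ≃ₗ[ℂ] TensorPow n :=
  (PiTensorProduct.congr fun _ : Fin n => e :
    (⨂[ℂ] _ : Fin n, C2) ≃ₗ[ℂ] (⨂[ℂ] _ : Fin n, C2))

theorem TensorPow.congr_tprod {n : ℕ} (e : C2 ≃ₗ[ℂ] C2) (x : Fin n → C2) :
    TensorPow.congr n e (TensorPow.tprod x) = TensorPow.tprod fun i => e (x i) :=
  PiTensorProduct.congr_tprod (fun _ : Fin n => e) x

theorem TensorPow.inner_congr {n : ℕ} (e : C2 ≃ₗᵢ[ℂ] C2) (x y : TensorPow n) :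
    ⟪TensorPow.congr n e.toLinearEquiv x, TensorPow.congr n e.toLinearEquiv y⟫_ℂ = ⟪x, y⟫_ℂ := by
  have hx : x ∈ Submodule.span ℂ (Set.range (TensorPow.tprod (n := n))) := by
    rw [TensorPow.span_tprod]; trivial
  have hy : y ∈ Submodule.span ℂ (Set.range (TensorPow.tprod (n := n))) := by
    rw [TensorPow.span_tprod]; trivial
  induction hx using Submodule.span_induction with
  | mem x h =>
    obtain ⟨a, rfl⟩ := h
    induction hy using Submodule.span_induction with
    | mem y h =>
      obtain ⟨b, rfl⟩ := h
      simp [TensorPow.congr_tprod, TensorPow.inner_tprod]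
    | zero => simp
    | add y z _ _ h1 h2 => simp [h1, h2]
    | smul c y _ h => simp [h]
  | zero => simp
  | add y z _ _ h1 h2 => simp [h1, h2]
  | smul c y _ h => simp [h]

/-- The unitary operator `e ⊗ ⋯ ⊗ e` on `(ℂ²)^{⊗ n}` for a unitary operator `e` on `ℂ²`. -/
def TensorPow.map (n : ℕ) : (C2 ≃ₗᵢ[ℂ] C2) →* (TensorPow n ≃ₗᵢ[ℂ] TensorPow n) where
  toFun e := (TensorPow.congr n e.toLinearEquiv).isometryOfInner (TensorPow.inner_congr e)
  map_one' := by
    ext x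
    exact congrArg (fun f : (⨂[ℂ] _ : Fin n, C2) →ₗ[ℂ] (⨂[ℂ] _ : Fin n, C2) => f x)
      (PiTensorProduct.map_id (R := ℂ) (s := fun _ : Fin n => C2))
  map_mul' e f := by
    ext x
    exact congrArg (fun f : (⨂[ℂ] _ : Fin n, C2) →ₗ[ℂ] (⨂[ℂ] _ : Fin n, C2) => f x)
      (PiTensorProduct.map_comp (fun _ : Fin n => e.toLinearEquiv.toLinearMap)
        (fun _ : Fin n => f.toLinearEquiv.toLinearMap))

theorem TensorPow.map_tprod {n : ℕ} (e : C2 ≃ₗᵢ[ℂ] C2) (x : Fin n → C2) :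
    TensorPow.map n e (TensorPow.tprod x) = TensorPow.tprod fun i => e (x i) :=
  TensorPow.congr_tprod e.toLinearEquiv x

/-- The action of a permutation on `(ℂ²)^{⊗ n}`,
`x₁ ⊗ ⋯ ⊗ xₙ ↦ x_{σ⁻¹ 1} ⊗ ⋯ ⊗ x_{σ⁻¹ n}`. -/
def TensorPow.perm {n : ℕ} (σ : Equiv.Perm (Fin n)) : TensorPow n ≃ₗ[ℂ] TensorPow n :=
  (PiTensorProduct.reindex ℂ (fun _ : Fin n => C2) σ :
    (⨂[ℂ] _ : Fin n, C2) ≃ₗ[ℂ] (⨂[ℂ] _ : Fin n, C2))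

theorem TensorPow.perm_tprod {n : ℕ} (σ : Equiv.Perm (Fin n)) (x : Fin n → C2) :
    TensorPow.perm σ (TensorPow.tprod x) = TensorPow.tprod fun i => x (σ.symm i) :=
  PiTensorProduct.reindex_tprod σ x

/-! ### The irreducible representations `ρ_n` of `SU(2)` on the symmetric tensors `L_n` -/

/-- The symmetric tensors in `(ℂ²)^{⊗ n}`. -/
def symTensors (n : ℕ) : Submodule ℂ (TensorPow n) where
  carrier := {x | ∀ σ : Equiv.Perm (Fin n), TensorPow.perm σ x = x}
  add_mem' hx hy σ := by rw [map_add, hx σ, hy σ]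
  zero_mem' σ := map_zero _
  smul_mem' c x hx σ := by rw [map_smul, hx σ]

/-- The Hilbert space `L_n` of symmetric tensors of degree `n`, with the inner product
of `(ℂ²)^{⊗ n}`. -/
def L (n : ℕ) : Type := symTensors n

instance (n : ℕ) : NormedAddCommGroup (L n) := inferInstanceAs (NormedAddCommGroup (symTensors n))

instance (n : ℕ) : InnerProductSpace ℂ (L n) :=
  inferInstanceAs (InnerProductSpace ℂ (symTensors n))

/-- The inclusion of `L_n` in `(ℂ²)^{⊗ n}`. -/
def L.incl (n : ℕ) : L n →ₗᵢ[ℂ] TensorPow n := (symTensors n).subtypeₗᵢ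

theorem L.range_incl (n : ℕ) : LinearMap.range (L.incl n).toLinearMap = symTensors n :=
  (symTensors n).range_subtype

theorem map_mem_symTensors {n : ℕ} (e : C2 ≃ₗᵢ[ℂ] C2) {x : TensorPow n} (hx : x ∈ symTensors n) :
    TensorPow.map n e x ∈ symTensors n := by
  intro σ
  have h : TensorPow.map n e (TensorPow.perm σ x) = TensorPow.perm σ (TensorPow.map n e x) :=
    PiTensorProduct.map_reindex (fun _ : Fin n => e.toLinearEquiv.toLinearMap) σ x
  rw [← h, hx σ]

/-- The restriction of a unitary representation to an invariant subspace. -/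
def restrictRep {G E : Type*} [Group G] [NormedAddCommGroup E] [InnerProductSpace ℂ E]
    (U : G →* (E ≃ₗᵢ[ℂ] E)) (S : Submodule ℂ E) (hS : ∀ g, ∀ x ∈ S, U g x ∈ S) :
    G →* (S ≃ₗᵢ[ℂ] S) where
  toFun g :=
    { toFun := fun x => ⟨U g x, hS g x x.2⟩
      invFun := fun x => ⟨U g⁻¹ x, hS g⁻¹ x x.2⟩
      left_inv := fun x => by ext; simp
      right_inv := fun x => by ext; simp
      map_add' := fun x y => by ext; simp
      map_smul' := fun c x => by ext; simp
      norm_map' := fun x => (U g).norm_map x }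
  map_one' := by ext x; simp
  map_mul' g h := by ext x; simp

/-- The fundamental representation of `SU(2)` on `ℂ²`, by matrix multiplication. -/
def fundRep : SU2 →* (C2 ≃ₗᵢ[ℂ] C2) :=
  (Unitary.linearIsometryEquiv (𝕜 := ℂ) (H := C2)).toMonoidHom.comp
    { toFun := fun g => ⟨Matrix.toEuclideanCLM (n := Fin 2) (𝕜 := ℂ) g,
        Unitary.map_mem _ (Matrix.specialUnitaryGroup_le_unitaryGroup g.2)⟩
      map_one' := by ext1; simp
      map_mul' := fun g h => by ext1; simp }

theorem fundRep_apply (g : SU2) (x : C2) (i : Fin 2) :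
    fundRep g x i = ∑ j, (g : Matrix (Fin 2) (Fin 2) ℂ) i j * x j := by
  change Matrix.toEuclideanCLM (n := Fin 2) (𝕜 := ℂ) g x i = _
  simp [Matrix.mulVec, dotProduct]

/-- The representation `ρ_n` of `SU(2)` on `L_n`, the restriction of the `n`-fold tensor power of
the fundamental representation. -/
def rho (n : ℕ) : SU2 →* (L n ≃ₗᵢ[ℂ] L n) :=
  (restrictRep ((TensorPow.map n).comp fundRep) (symTensors n)
    fun g _ hx => map_mem_symTensors (fundRep g) hx :
    SU2 →* (symTensors n ≃ₗᵢ[ℂ] symTensors n))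

theorem incl_rho (n : ℕ) (g : SU2) (x : L n) :
    L.incl n (rho n g x) = TensorPow.map n (fundRep g) (L.incl n x) := rfl

/-! ### The determinant of a representation -/

/-- The determinant `det(τ, H)`: the subspace of `H ⊗ H` of vectors invariant under
`τ(g) ⊗ τ(g)` for all `g ∈ SU(2)`. -/
def det {H : Type*} [NormedAddCommGroup H] [InnerProductSpace ℂ H]
    (τ : SU2 →* (H ≃ₗᵢ[ℂ] H)) : Submodule ℂ (H ⊗[ℂ] H) where
  carrier := {ξ | ∀ g : SU2, TensorProduct.congrIsometry (τ g) (τ g) ξ = ξ}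
  add_mem' hx hy g := by rw [map_add, hx g, hy g]
  zero_mem' g := map_zero _
  smul_mem' c x hx g := by rw [map_smul, hx g]

/-! ### Hilbert space direct sums -/

theorem memℓp_map {E F : ℕ → Type*}
    [∀ m, NormedAddCommGroup (E m)] [∀ m, InnerProductSpace ℂ (E m)]
    [∀ m, NormedAddCommGroup (F m)] [∀ m, InnerProductSpace ℂ (F m)]
    (e : ∀ m, E m ≃ₗᵢ[ℂ] F m) (x : lp E 2) : Memℓp (fun m => e m (x m)) 2 :=
  (lp.memℓp x).mono' fun m => ((e m).norm_map (x m)).le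

/-- The direct sum of a sequence of unitary operators. -/
def lpCongr {E F : ℕ → Type*}
    [∀ m, NormedAddCommGroup (E m)] [∀ m, InnerProductSpace ℂ (E m)]
    [∀ m, NormedAddCommGroup (F m)] [∀ m, InnerProductSpace ℂ (F m)]
    (e : ∀ m, E m ≃ₗᵢ[ℂ] F m) : lp E 2 ≃ₗᵢ[ℂ] lp F 2 where
  toFun x := ⟨fun m => e m (x m), memℓp_map e x⟩
  invFun x := ⟨fun m => (e m).symm (x m), memℓp_map (fun m => (e m).symm) x⟩
  left_inv x := by ext m; exact (e m).symm_apply_apply (x m)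
  right_inv x := by ext m; exact (e m).apply_symm_apply (x m)
  map_add' x y := by ext m; exact (e m).map_add (x m) (y m)
  map_smul' c x := by ext m; exact (e m).map_smul c (x m)
  norm_map' x := by
    have h : 0 < (2 : ENNReal).toReal := by norm_num
    rw [lp.norm_eq_tsum_rpow h, lp.norm_eq_tsum_rpow h]
    congr 2
    funext m
    exact congrArg (· ^ _) ((e m).norm_map (x m))

theorem lpCongr_apply {E F : ℕ → Type*}
    [∀ m, NormedAddCommGroup (E m)] [∀ m, InnerProductSpace ℂ (E m)]
    [∀ m, NormedAddCommGroup (F m)] [∀ m, InnerProductSpace ℂ (F m)]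
    (e : ∀ m, E m ≃ₗᵢ[ℂ] F m) (x : lp E 2) (m : ℕ) : lpCongr e x m = e m (x m) := rfl

/-- The inclusion `x ↦ x δ_m` of the `m`-th summand in a Hilbert space direct sum. -/
def lpSingle {E : ℕ → Type*} [∀ m, NormedAddCommGroup (E m)] [∀ m, InnerProductSpace ℂ (E m)]
    (m : ℕ) : E m →ₗᵢ[ℂ] lp E 2 where
  toLinearMap := lp.lsingle 2 m
  norm_map' x := lp.norm_single (by norm_num) m x

/-- `E^{⊕ κ}`, the orthogonal direct sum of copies of `E` indexed by `κ`. -/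
abbrev Copies (κ : Type*) (E : Type*) : Type _ := PiLp 2 fun _ : κ => E

/-- `⨁_m L_m^{⊕ k_m}`. -/
abbrev IsotypicSum (k : ℕ → ℕ) : Type := lp (fun m => Copies (Fin (k m)) (L m)) 2

/-- The representation `⨁_m ρ_m^{⊕ k_m}` on `⨁_m L_m^{⊕ k_m}`. -/
def isotypicRep (k : ℕ → ℕ) : SU2 →* (IsotypicSum k ≃ₗᵢ[ℂ] IsotypicSum k) where
  toFun g := lpCongr fun m => LinearIsometryEquiv.piLpCongrRight 2 fun _ : Fin (k m) => rho m g
  map_one' := by ext x m i; simp [lpCongr_apply]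
  map_mul' g h := by ext x m i; simp [lpCongr_apply]

theorem isotypicRep_apply (k : ℕ → ℕ) (g : SU2) (x : IsotypicSum k) (m : ℕ) (i : Fin (k m)) :
    isotypicRep k g x m i = rho m g (x m i) := rfl

/-- `⨁_m (L_m ⊗ L_m)^{⊕ k_m²}`, where the `k_m²` copies are indexed by pairs. -/
abbrev SquareSum (k : ℕ → ℕ) : Type :=
  lp (fun m => Copies (Fin (k m) × Fin (k m)) (L m ⊗[ℂ] L m)) 2

/-- The subspace `⨁_m det(ρ_m, L_m)^{⊕ k_m²}` of `⨁_m (L_m ⊗ L_m)^{⊕ k_m²}`. -/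
def detSum (k : ℕ → ℕ) : Submodule ℂ (SquareSum k) where
  carrier := {x | ∀ (m : ℕ) (p : Fin (k m) × Fin (k m)), x m p ∈ det (rho m)}
  add_mem' hx hy m p := (det (rho m)).add_mem (hx m p) (hy m p)
  zero_mem' m _ := (det (rho m)).zero_mem
  smul_mem' c _ hx m p := (det (rho m)).smul_mem c (hx m p)

theorem sum_single {κ E : Type*} [Fintype κ] [DecidableEq κ] [NormedAddCommGroup E] (x : Copies κ E) :
    ∑ i, (PiLp.single 2 i (x i) : Copies κ E) = x := by
  ext j
  simp [Finset.sum_apply, Pi.single_apply]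

section Isometries

variable {E F G H E' F' : Type*}
  [NormedAddCommGroup E] [InnerProductSpace ℂ E] [NormedAddCommGroup F] [InnerProductSpace ℂ F]
  [NormedAddCommGroup E'] [InnerProductSpace ℂ E'] [NormedAddCommGroup F'] [InnerProductSpace ℂ F']
  [NormedAddCommGroup G] [InnerProductSpace ℂ G] [NormedAddCommGroup H] [InnerProductSpace ℂ H]

theorem inner_map_map_eq_zero (f : E →ₗᵢ[ℂ] G) (f' : E' →ₗᵢ[ℂ] G) (g : F →ₗᵢ[ℂ] H)
    (g' : F' →ₗᵢ[ℂ] H)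
    (h : (∀ a b, ⟪f a, f' b⟫_ℂ = 0) ∨ (∀ a b, ⟪g a, g' b⟫_ℂ = 0))
    (x : E ⊗[ℂ] F) (y : E' ⊗[ℂ] F') :
    ⟪TensorProduct.mapIsometry f g x, TensorProduct.mapIsometry f' g' y⟫_ℂ = 0 := by
  induction x with
  | zero => simp
  | add a b ha hb => rw [map_add, inner_add_left, ha, hb, add_zero]
  | tmul a b =>
    induction y with
    | zero => simp
    | add a b ha hb => rw [map_add, inner_add_right, ha, hb, add_zero]
    | tmul c d => rcases h with h | h <;> simp [h]

/-- The inclusion of the `i`-th summand in `E^{⊕ κ}`. -/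
def copiesSingle {κ : Type*} [Fintype κ] [DecidableEq κ] (i : κ) : E →ₗᵢ[ℂ] Copies κ E where
  toFun x := PiLp.single 2 i x
  map_add' x y := by ext j; by_cases h : j = i <;> simp [h]
  map_smul' c x := by ext j; by_cases h : j = i <;> simp [h]
  norm_map' x := by simp

theorem copiesSingle_apply {κ : Type*} [Fintype κ] [DecidableEq κ] (i : κ) (x : E) :
    copiesSingle i x = PiLp.single 2 i x := rfl

theorem inner_copiesSingle {κ : Type*} [Fintype κ] [DecidableEq κ] {i j : κ} (h : i ≠ j)
    (x y : E) : ⟪copiesSingle i x, copiesSingle j y⟫_ℂ = 0 := by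
  rw [PiLp.inner_apply]
  refine Finset.sum_eq_zero fun l _ => ?_
  by_cases hl : l = i
  · subst hl; simp [copiesSingle_apply, h]
  · simp [copiesSingle_apply, hl]

/-- The linear map underlying `copiesTensor`. -/
def copiesTensorMap (κ : Type*) [Fintype κ] [DecidableEq κ] (E : Type*) [NormedAddCommGroup E]
    [InnerProductSpace ℂ E] :
    Copies (κ × κ) (E ⊗[ℂ] E) →ₗ[ℂ] Copies κ E ⊗[ℂ] Copies κ E where
  toFun x := ∑ p : κ × κ, TensorProduct.mapIsometry (copiesSingle p.1) (copiesSingle p.2) (x p)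
  map_add' x y := by simp [Finset.sum_add_distrib]
  map_smul' c x := by simp [Finset.smul_sum]

theorem copiesTensorMap_single {κ : Type*} [Fintype κ] [DecidableEq κ] (i j : κ) (ξ η : E) :
    copiesTensorMap κ E (PiLp.single 2 (i, j) (ξ ⊗ₜ[ℂ] η))
      = PiLp.single 2 i ξ ⊗ₜ[ℂ] PiLp.single 2 j η := by
  change ∑ p : κ × κ, TensorProduct.mapIsometry (copiesSingle p.1) (copiesSingle p.2)
    ((PiLp.single 2 (i, j) (ξ ⊗ₜ[ℂ] η) : Copies (κ × κ) (E ⊗[ℂ] E)) p) = _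
  rw [Finset.sum_eq_single (i, j)]
  · simp [copiesSingle_apply]
  · intro p _ hp
    simp [hp]
  · simp

theorem inner_copiesTensorMap {κ : Type*} [Fintype κ] [DecidableEq κ]
    (x y : Copies (κ × κ) (E ⊗[ℂ] E)) :
    ⟪copiesTensorMap κ E x, copiesTensorMap κ E y⟫_ℂ = ⟪x, y⟫_ℂ := by
  change ⟪∑ p : κ × κ, TensorProduct.mapIsometry (copiesSingle p.1) (copiesSingle p.2) (x p),
    ∑ p : κ × κ, TensorProduct.mapIsometry (copiesSingle p.1) (copiesSingle p.2) (y p)⟫_ℂ = _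
  rw [sum_inner, PiLp.inner_apply]
  refine Finset.sum_congr rfl fun p _ => ?_
  rw [inner_sum, Finset.sum_eq_single p]
  · exact LinearIsometry.inner_map_map _ _ _
  · intro q _ hq
    refine inner_map_map_eq_zero _ _ _ _ ?_ _ _
    by_cases h : p.1 = q.1
    · right
      exact inner_copiesSingle fun h' => hq (Prod.ext h h').symm
    · left
      exact inner_copiesSingle h
  · simp

theorem copiesTensorMap_surjective (κ : Type*) [Fintype κ] [DecidableEq κ] (E : Type*)
    [NormedAddCommGroup E] [InnerProductSpace ℂ E] :
    Function.Surjective (copiesTensorMap κ E) := by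
  intro z
  induction z with
  | zero => exact ⟨0, map_zero _⟩
  | add a b ha hb =>
    obtain ⟨x, rfl⟩ := ha
    obtain ⟨y, rfl⟩ := hb
    exact ⟨x + y, map_add _ _ _⟩
  | tmul a b =>
    refine ⟨∑ i, ∑ j, PiLp.single 2 (i, j) (a i ⊗ₜ[ℂ] b j), ?_⟩
    simp only [map_sum, copiesTensorMap_single]
    conv_rhs => rw [← sum_single a, ← sum_single b]
    simp only [TensorProduct.sum_tmul, TensorProduct.tmul_sum]
    exact Finset.sum_comm

/-- The canonical unitary operator `(E ⊗ E)^{⊕ κ × κ} ≅ E^{⊕ κ} ⊗ E^{⊕ κ}`; it sends `ξ ⊗ η` in the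
summand `(i, j)` to the tensor product of `ξ` in the summand `i` and `η` in the summand `j`. -/
def copiesTensor (κ : Type*) [Fintype κ] [DecidableEq κ] (E : Type*) [NormedAddCommGroup E]
    [InnerProductSpace ℂ E] :
    Copies (κ × κ) (E ⊗[ℂ] E) ≃ₗᵢ[ℂ] Copies κ E ⊗[ℂ] Copies κ E :=
  (LinearEquiv.ofBijective (copiesTensorMap κ E)
    ⟨((copiesTensorMap κ E).isometryOfInner inner_copiesTensorMap).injective,
      copiesTensorMap_surjective κ E⟩).isometryOfInner inner_copiesTensorMap

theorem copiesTensor_single {κ : Type*} [Fintype κ] [DecidableEq κ] (i j : κ) (ξ η : E) :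
    copiesTensor κ E (PiLp.single 2 (i, j) (ξ ⊗ₜ[ℂ] η))
      = PiLp.single 2 i ξ ⊗ₜ[ℂ] PiLp.single 2 j η :=
  copiesTensorMap_single i j ξ η

end Isometries

/-- The canonical unitary operator
`⨁_m (L_m ⊗ L_m)^{⊕ k_m²} ≅ ⨁_m (L_m^{⊕ k_m} ⊗ L_m^{⊕ k_m})`. -/
def squareSumEquiv (k : ℕ → ℕ) :
    SquareSum k ≃ₗᵢ[ℂ] lp (fun m => Copies (Fin (k m)) (L m) ⊗[ℂ] Copies (Fin (k m)) (L m)) 2 :=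
  lpCongr fun m => copiesTensor (Fin (k m)) (L m)

section Iota

variable {H : Type*} [NormedAddCommGroup H] [InnerProductSpace ℂ H]

/-- The isometry `ξ ↦ V (ξ δ_m)` from `L_m^{⊕ k_m}` to `H`. -/
def summand {k : ℕ → ℕ} (V : IsotypicSum k ≃ₗᵢ[ℂ] H) (m : ℕ) :
    Copies (Fin (k m)) (L m) →ₗᵢ[ℂ] H :=
  V.toLinearIsometry.comp (lpSingle (E := fun m => Copies (Fin (k m)) (L m)) m)

theorem summand_apply {k : ℕ → ℕ} (V : IsotypicSum k ≃ₗᵢ[ℂ] H) (m : ℕ)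
    (ξ : Copies (Fin (k m)) (L m)) :
    summand V m ξ = V (lp.single (E := fun m => Copies (Fin (k m)) (L m)) 2 m ξ) := rfl

theorem inner_summand {k : ℕ → ℕ} (V : IsotypicSum k ≃ₗᵢ[ℂ] H) {m l : ℕ} (h : m ≠ l)
    (ξ : Copies (Fin (k m)) (L m)) (η : Copies (Fin (k l)) (L l)) :
    ⟪summand V m ξ, summand V l η⟫_ℂ = 0 := by
  rw [summand_apply, summand_apply, V.inner_map_map, lp.inner_single_left,
    lp.single_apply_ne _ _ _ h, inner_zero_right]

theorem orthogonalFamily_summand {k : ℕ → ℕ} (V : IsotypicSum k ≃ₗᵢ[ℂ] H) :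
    OrthogonalFamily ℂ (fun m => Copies (Fin (k m)) (L m) ⊗[ℂ] Copies (Fin (k m)) (L m))
      fun m => TensorProduct.mapIsometry (summand V m) (summand V m) :=
  fun _ _ h => inner_map_map_eq_zero _ _ _ _ (Or.inl (inner_summand V h))

variable [FiniteDimensional ℂ H]

instance : CompleteSpace (H ⊗[ℂ] H) := FiniteDimensional.complete ℂ _

/-- The isometry `ι : ⨁_m (L_m^{⊕ k_m} ⊗ L_m^{⊕ k_m}) → H ⊗ H`, given in degree `m` by
`ι (ξ ⊗ η) = V (ξ δ_m) ⊗ V (η δ_m)`; see `iota_single`. -/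
def iota {k : ℕ → ℕ} (V : IsotypicSum k ≃ₗᵢ[ℂ] H) :
    lp (fun m => Copies (Fin (k m)) (L m) ⊗[ℂ] Copies (Fin (k m)) (L m)) 2 →ₗᵢ[ℂ] H ⊗[ℂ] H :=
  (orthogonalFamily_summand V).linearIsometry

theorem iota_single {k : ℕ → ℕ} (V : IsotypicSum k ≃ₗᵢ[ℂ] H) (m : ℕ)
    (ξ η : Copies (Fin (k m)) (L m)) :
    iota V (lp.single 2 m (ξ ⊗ₜ[ℂ] η))
      = V (lp.single (E := fun m => Copies (Fin (k m)) (L m)) 2 m ξ) ⊗ₜ[ℂ]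
        V (lp.single (E := fun m => Copies (Fin (k m)) (L m)) 2 m η) := by
  rw [iota, OrthogonalFamily.linearIsometry_apply_single]
  rfl

end Iota

end SU2Det

end

open scoped TensorProduct InnerProductSpace

noncomputable section

namespace SU2Det

/-! ### Coordinates and powers of vectors -/

/-! A vector `ξ` of `H ⊗ H` amounts to the bilinear form `⟪ξ, x ⊗ y⟫` on `H`, and `ξ` lies in `det
τ` exactly when this form is invariant (`mem_det_iff`). Restricted to a pair of copies of `L_m` and
`L_l` in `H`, it becomes an invariant form on `L_m × L_l`. Such forms vanish for `m ≠ l`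
(`IsInvariant.eq_zero`) and are multiples of the power of the 2 × 2 determinant for `m = l`
(`IsInvariant.exists_eq_smul`).

The classification is direct. A form is determined by its values on powers `u ⊗ ⋯ ⊗ u` and `v ⊗ ⋯ ⊗
v`, and `SU(2)` moves a multiple of `e₀ = (1, 0)` to any `u`, so only the homogeneous polynomial `v
↦ B (e₀^m, v^n)` matters. The diagonal torus kills each coefficient of `v₀^(n-j) v₁^j` except the
one with `2j = m + n`.

Hence the singlets placed in pairs of equal-degree copies form an orthogonal basis of `det τ`
(`span_singletFamily`). Counting them gives the dimension, and each is the image of a singlet in one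
summand of `detSum`, which identifies the image of the isometry (`map_detSum`). -/

instance (n : ℕ) : FiniteDimensional ℂ (TensorPow n) :=
  (TensorPow.basis n).finiteDimensional_of_finite

instance (n : ℕ) : FiniteDimensional ℂ (L n) :=
  inferInstanceAs (FiniteDimensional ℂ (symTensors n))

theorem TensorPow.linearMap_ext {n : ℕ} {F : Type*} [AddCommGroup F] [Module ℂ F]
    {f g : TensorPow n →ₗ[ℂ] F} (h : ∀ x, f (TensorPow.tprod x) = g (TensorPow.tprod x)) :
    f = g :=
  LinearMap.ext_on_range (TensorPow.span_tprod n) h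

theorem TensorPow.coords_perm {n : ℕ} (σ : Equiv.Perm (Fin n)) (x : TensorPow n)
    (p : Fin n → Fin 2) :
    TensorPow.coords n (TensorPow.perm σ x) p = TensorPow.coords n x (p ∘ σ) := by
  let ev : (Fin n → Fin 2) → TensorPow n →ₗ[ℂ] ℂ := fun q =>
    (EuclideanSpace.proj q : EuclideanSpace ℂ (Fin n → Fin 2) →L[ℂ] ℂ).toLinearMap ∘ₗ
      (TensorPow.coords n).toLinearMap
  have h : ev p ∘ₗ (TensorPow.perm σ).toLinearMap = ev (p ∘ σ) := by
    refine TensorPow.linearMap_ext fun y => ?_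
    change TensorPow.coords n (TensorPow.perm σ (TensorPow.tprod y)) p
      = TensorPow.coords n (TensorPow.tprod y) (p ∘ σ)
    rw [TensorPow.perm_tprod, TensorPow.coords_tprod, TensorPow.coords_tprod]
    exact Fintype.prod_equiv σ.symm _ _ fun i => by simp
  exact LinearMap.congr_fun h x

/-- The number of indices at which `p` takes the value `1`. -/
def weight {n : ℕ} (p : Fin n → Fin 2) : ℕ := (Finset.univ.filter fun i => p i = 1).card

theorem weight_le {n : ℕ} (p : Fin n → Fin 2) : weight p ≤ n :=
  (Finset.card_filter_le _ _).trans (by simp)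

theorem prod_apply_eq {n : ℕ} (v : C2) (p : Fin n → Fin 2) :
    ∏ i, v (p i) = v 0 ^ (n - weight p) * v 1 ^ weight p := by
  have hc : (Finset.univ.filter fun i => ¬ p i = 1).card = n - weight p := by
    have := Finset.card_filter_add_card_filter_not (s := Finset.univ) (fun i => p i = 1)
    simp only [Finset.card_univ, Fintype.card_fin] at this
    unfold weight
    omega
  rw [← Finset.prod_filter_mul_prod_filter_not Finset.univ (fun i => p i = 1), mul_comm]
  congr 1
  · rw [← hc]
    refine Finset.prod_eq_pow_card fun i hi => ?_
    rw [Finset.mem_filter] at hi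
    rw [show p i = 0 by have := hi.2; omega]
  · refine Finset.prod_eq_pow_card fun i hi => ?_
    rw [(Finset.mem_filter.mp hi).2]

/-- The fibres of `p` and `q` over each value have equal size, so fibrewise bijections glue to a
permutation. Consequently the coordinates of a symmetric tensor depend only on the weight. -/
theorem exists_perm_of_weight_eq {n : ℕ} {p q : Fin n → Fin 2} (h : weight p = weight q) :
    ∃ σ : Equiv.Perm (Fin n), q ∘ σ = p := by
  have hcard : ∀ c : Fin 2, Fintype.card {i // p i = c} = Fintype.card {i // q i = c} := by
    have h1 : Fintype.card {i // p i = 1} = Fintype.card {i // q i = 1} := by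
      simpa [Fintype.card_subtype, weight] using h
    have hne : ∀ r : Fin n → Fin 2,
        Fintype.card {i // r i = 0} = Fintype.card {i // ¬ r i = 1} := fun r =>
      Fintype.card_congr (Equiv.subtypeEquivRight fun i => by omega)
    intro c
    fin_cases c
    · change Fintype.card {i // p i = 0} = Fintype.card {i // q i = 0}
      rw [hne, hne, Fintype.card_subtype_compl, Fintype.card_subtype_compl, h1]
    · exact h1
  exact ⟨Equiv.ofFiberEquiv fun c => Fintype.equivOfCardEq (hcard c),
    funext fun i => Equiv.ofFiberEquiv_map _ i⟩

/-- The symmetric tensor `v ⊗ ⋯ ⊗ v`. -/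
def L.pow (n : ℕ) (v : C2) : L n :=
  (⟨TensorPow.tprod fun _ => v, fun σ => TensorPow.perm_tprod σ _⟩ : symTensors n)

theorem L.incl_pow (n : ℕ) (v : C2) : L.incl n (L.pow n v) = TensorPow.tprod fun _ => v := rfl

theorem rho_pow (n : ℕ) (g : SU2) (v : C2) : rho n g (L.pow n v) = L.pow n (fundRep g v) :=
  (L.incl n).injective (by rw [incl_rho, L.incl_pow, L.incl_pow, TensorPow.map_tprod])

theorem L.pow_smul (n : ℕ) (c : ℂ) (v : C2) : L.pow n (c • v) = c ^ n • L.pow n v := by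
  apply (L.incl n).injective
  rw [map_smul, L.incl_pow, L.incl_pow]
  apply (TensorPow.coords n).injective
  ext p
  rw [map_smul, PiLp.smul_apply, TensorPow.coords_tprod, TensorPow.coords_tprod]
  simp [Finset.prod_mul_distrib]

theorem L.inner_pow {n : ℕ} (x : L n) (v : C2) :
    ⟪x, L.pow n v⟫_ℂ = ∑ p : Fin n → Fin 2, star (TensorPow.coords n (L.incl n x) p) *
      (v 0 ^ (n - weight p) * v 1 ^ weight p) := by
  rw [← (L.incl n).inner_map_map, L.incl_pow, TensorPow.inner_def, PiLp.inner_apply]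
  refine Finset.sum_congr rfl fun p _ => ?_
  rw [TensorPow.coords_tprod, prod_apply_eq]
  simp [mul_comm]

theorem exists_eq_inner {E : Type*} [NormedAddCommGroup E] [InnerProductSpace ℂ E]
    [FiniteDimensional ℂ E] (f : E →ₗ[ℂ] ℂ) : ∃ x : E, ∀ y, f y = ⟪x, y⟫_ℂ := by
  have : CompleteSpace E := FiniteDimensional.complete ℂ E
  refine ⟨(InnerProductSpace.toDual ℂ E).symm (LinearMap.toContinuousLinearMap f), fun y => ?_⟩
  simp

/-- A linear functional on `L_n` evaluated at `v ⊗ ⋯ ⊗ v` is a homogeneous polynomial in `v`. -/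
theorem L.exists_coeff {n : ℕ} (f : L n →ₗ[ℂ] ℂ) :
    ∃ a : ℕ → ℂ, ∀ v : C2,
      f (L.pow n v) = ∑ j ∈ Finset.range (n + 1), a j * (v 0 ^ (n - j) * v 1 ^ j) := by
  obtain ⟨x, hx⟩ := exists_eq_inner f
  -- The monomial contributed by `p` depends only on its weight, so the coefficients are collected
  -- by weight.
  refine ⟨fun j => ∑ p : Fin n → Fin 2 with weight p = j,
    star (TensorPow.coords n (L.incl n x) p), fun v => ?_⟩
  rw [hx, L.inner_pow, ← Finset.sum_fiberwise_of_maps_to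
    (g := weight) (t := Finset.range (n + 1)) fun p _ => by
      have := weight_le p; simp; omega]
  refine Finset.sum_congr rfl fun j _ => ?_
  rw [Finset.sum_mul]
  refine Finset.sum_congr rfl fun p hp => ?_
  rw [(Finset.mem_filter.mp hp).2]

/-- The powers `v ⊗ ⋯ ⊗ v` separate linear functionals on `L_n`. -/
theorem L.linearMap_eq_zero {n : ℕ} {f : L n →ₗ[ℂ] ℂ} (hf : ∀ v, f (L.pow n v) = 0) : f = 0 := by
  obtain ⟨x, hx⟩ := exists_eq_inner f
  -- This is the value of `f` on the power of `(1, t)`, as a polynomial in `t`.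
  let P : Polynomial ℂ := ∑ p : Fin n → Fin 2,
    Polynomial.C (star (TensorPow.coords n (L.incl n x) p)) * Polynomial.X ^ weight p
  have hP : P = 0 := by
    refine Polynomial.funext fun t => ?_
    have h := hf !₂[1, t]
    rw [hx, L.inner_pow] at h
    simpa [P, Polynomial.eval_finsetSum] using h
  have hsymm : ∀ p q : Fin n → Fin 2, weight p = weight q →
      TensorPow.coords n (L.incl n x) p = TensorPow.coords n (L.incl n x) q := by
    intro p q h
    obtain ⟨σ, rfl⟩ := exists_perm_of_weight_eq h
    rw [← TensorPow.coords_perm, show TensorPow.perm σ (L.incl n x) = L.incl n x from x.2 σ]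
  have hx0 : x = 0 := by
    apply (L.incl n).injective
    apply (TensorPow.coords n).injective
    ext q
    have h := congrArg (fun Q : Polynomial ℂ => Q.coeff (weight q)) hP
    simp only [P, Polynomial.finsetSum_coeff, Polynomial.coeff_C_mul_X_pow,
      Polynomial.coeff_zero] at h
    -- By symmetry the coefficient is the size of the weight class times a single conjugated
    -- coordinate, and the class contains `q`.
    rw [← Finset.sum_filter, Finset.sum_congr rfl (g := fun _ =>
      star (TensorPow.coords n (L.incl n x) q)) fun p hp => by
        rw [hsymm p q (Finset.mem_filter.mp hp).2.symm], Finset.sum_const, smul_eq_zero] at h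
    rcases h with h | h
    · exact absurd h (Finset.card_ne_zero_of_mem (a := q) (by simp))
    · simpa using h
  ext y
  simp [hx, hx0]

/-! ### The invariant bilinear form -/

/-- The determinant `det (x, y)` of two vectors in `ℂ²`. -/
def area (x y : C2) : ℂ := x 0 * y 1 - x 1 * y 0

/-- The group element multiplies `area` by its determinant, which is 1. -/
theorem area_fundRep (g : SU2) (x y : C2) : area (fundRep g x) (fundRep g y) = area x y := by
  have hg : (g : Matrix (Fin 2) (Fin 2) ℂ).det = 1 := (Matrix.mem_specialUnitaryGroup_iff.mp g.2).2
  rw [Matrix.det_fin_two] at hg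
  simp only [area, fundRep_apply, Fin.sum_univ_two]
  linear_combination (x 0 * y 1 - x 1 * y 0) * hg

/-- The bilinear form on `(ℂ²)^{⊗ n}` that is the `n`-th tensor power of `area`. -/
def areaForm (n : ℕ) : TensorPow n →ₗ[ℂ] TensorPow n →ₗ[ℂ] ℂ :=
  -- Expanding a product of factors `x 0 * y 1 - x 1 * y 0` selects index `p i` for `x`, the
  -- opposite index `1 - p i` for `y`, and a sign for each `p i = 1`.
  LinearMap.mk₂ ℂ (fun x y => ∑ p : Fin n → Fin 2, (∏ i, if p i = 0 then (1 : ℂ) else -1) *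
      (TensorPow.coords n x p * TensorPow.coords n y fun i => 1 - p i))
    (fun x y z => by simp [add_mul, mul_add, Finset.sum_add_distrib])
    (fun c x y => by simp only [map_smul, PiLp.smul_apply, smul_eq_mul, Finset.mul_sum]
                     exact Finset.sum_congr rfl fun p _ => by ring)
    (fun x y z => by simp [mul_add, Finset.sum_add_distrib])
    (fun c x y => by simp only [map_smul, PiLp.smul_apply, smul_eq_mul, Finset.mul_sum]
                     exact Finset.sum_congr rfl fun p _ => by ring)

theorem areaForm_tprod {n : ℕ} (x y : Fin n → C2) :
    areaForm n (TensorPow.tprod x) (TensorPow.tprod y) = ∏ i, area (x i) (y i) := by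
  have h : ∀ i, area (x i) (y i)
      = ∑ a : Fin 2, (if a = 0 then (1 : ℂ) else -1) * (x i a * y i (1 - a)) := fun i => by
    simp [area, Fin.sum_univ_two, sub_eq_add_neg]
  simp only [h]
  rw [Finset.prod_univ_sum]
  simp only [Finset.prod_mul_distrib, Fintype.piFinset_univ]
  simp [areaForm, TensorPow.coords_tprod]

theorem areaForm_map {n : ℕ} (g : SU2) (x y : TensorPow n) :
    areaForm n (TensorPow.map n (fundRep g) x) (TensorPow.map n (fundRep g) y)
      = areaForm n x y := by
  let T : TensorPow n →ₗ[ℂ] TensorPow n := (TensorPow.map n (fundRep g)).toLinearEquiv.toLinearMap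
  have h : (areaForm n).compl₁₂ T T = areaForm n := by
    refine TensorPow.linearMap_ext fun a => TensorPow.linearMap_ext fun b => ?_
    change areaForm n (TensorPow.map n (fundRep g) (TensorPow.tprod a))
      (TensorPow.map n (fundRep g) (TensorPow.tprod b)) = _
    simp only [TensorPow.map_tprod, areaForm_tprod, area_fundRep]
  exact LinearMap.congr_fun₂ h x y

/-- The restriction of `areaForm` to symmetric tensors. -/
def symAreaForm (n : ℕ) : L n →ₗ[ℂ] L n →ₗ[ℂ] ℂ :=
  (areaForm n).compl₁₂ (L.incl n).toLinearMap (L.incl n).toLinearMap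

theorem symAreaForm_pow (n : ℕ) (u v : C2) :
    symAreaForm n (L.pow n u) (L.pow n v) = area u v ^ n := by
  change areaForm n (TensorPow.tprod fun _ => u) (TensorPow.tprod fun _ => v) = _
  rw [areaForm_tprod]
  simp

theorem symAreaForm_rho {n : ℕ} (g : SU2) (x y : L n) :
    symAreaForm n (rho n g x) (rho n g y) = symAreaForm n x y :=
  areaForm_map g (L.incl n x) (L.incl n y)

/-! ### Invariant bilinear forms on `L_m × L_n` -/

/-- The element of `SU(2)` with first column `(α, β)`. -/
def suMk (α β : ℂ) (h : α * star α + β * star β = 1) : SU2 :=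
  ⟨!![α, -star β; β, star α], by
    rw [Matrix.mem_specialUnitaryGroup_iff, Matrix.mem_unitaryGroup_iff']
    constructor
    · ext i j
      fin_cases i <;> fin_cases j <;>
        simp [Matrix.mul_apply, Fin.sum_univ_two, Matrix.star_apply] at h ⊢
      · linear_combination h
      · ring
      · ring
      · linear_combination h
    · rw [Matrix.det_fin_two]
      simp at h ⊢
      linear_combination h⟩

theorem fundRep_suMk (α β : ℂ) (h : α * star α + β * star β = 1) (v : C2) :
    fundRep (suMk α β h) v = !₂[α * v 0 - star β * v 1, β * v 0 + star α * v 1] := by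
  ext i
  rw [fundRep_apply]
  fin_cases i <;> simp [suMk, Fin.sum_univ_two, sub_eq_add_neg]

/-- `SU(2)` acts transitively on the unit sphere: a unit vector is the first column of an element,
and `a` is the norm of `u`. -/
theorem exists_fundRep_eq (u : C2) : ∃ (g : SU2) (a : ℂ), fundRep g (a • !₂[1, 0]) = u := by
  by_cases hu : u = 0
  · exact ⟨1, 0, by simp [hu]⟩
  have hn : (‖u‖ : ℂ) ≠ 0 := by simpa using hu
  have hs : u 0 * star (u 0) + u 1 * star (u 1) = (‖u‖ : ℂ) ^ 2 := by
    rw [← Complex.ofReal_pow, EuclideanSpace.norm_sq_eq, Fin.sum_univ_two]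
    push_cast
    simp [Complex.mul_conj, Complex.normSq_eq_norm_sq]
  refine ⟨suMk (u 0 / ‖u‖) (u 1 / ‖u‖) ?_, ‖u‖, ?_⟩
  · simp only [star_div₀, Complex.star_def, Complex.conj_ofReal] at hs ⊢
    field_simp
    linear_combination hs
  · rw [fundRep_suMk]
    ext i
    fin_cases i <;> simp <;> field_simp

/-- Invariance of a bilinear form on `L_m × L_n`. -/
def IsInvariant {m n : ℕ} (B : L m →ₗ[ℂ] L n →ₗ[ℂ] ℂ) : Prop :=
  ∀ g x y, B (rho m g x) (rho n g y) = B x y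

theorem IsInvariant.flip {m n : ℕ} {B : L m →ₗ[ℂ] L n →ₗ[ℂ] ℂ} (hB : IsInvariant B) :
    IsInvariant B.flip :=
  fun g x y => hB g y x

/-- Invariance under the diagonal torus: only one coefficient survives. -/
theorem IsInvariant.exists_coeff {m n : ℕ} {B : L m →ₗ[ℂ] L n →ₗ[ℂ] ℂ} (hB : IsInvariant B) :
    ∃ a : ℕ → ℂ, (∀ j ≤ n, 2 * j ≠ m + n → a j = 0) ∧ ∀ v : C2,
      B (L.pow m !₂[1, 0]) (L.pow n v)
        = ∑ j ∈ Finset.range (n + 1), a j * (v 0 ^ (n - j) * v 1 ^ j) := by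
  obtain ⟨a, ha⟩ := L.exists_coeff (B (L.pow m !₂[1, 0]))
  refine ⟨a, fun j hj hne => ?_, ha⟩
  -- The order of the root of unity `z` exceeds both exponents `2 * j` and `m + n` compared below,
  -- so equal powers force equal exponents.
  have hN : 2 * (m + n) + 1 ≠ 0 := by omega
  have hz := Complex.isPrimitiveRoot_exp _ hN
  set z := Complex.exp (2 * Real.pi * Complex.I / ((2 * (m + n) + 1 : ℕ) : ℂ))
  have hz1 : z * star z = 1 := by
    rw [Complex.star_def, Complex.mul_conj, Complex.normSq_eq_norm_sq, hz.norm'_eq_one hN]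
    simp
  let g : SU2 := suMk z 0 (by simpa using hz1)
  have hg1 : fundRep g !₂[1, 0] = z • !₂[1, 0] := by
    rw [fundRep_suMk]; ext i; fin_cases i <;> simp
  -- The torus element `diag(z, z̄)` scales the ratio of the coordinates by `z̄ ^ 2`, which the
  -- factor `z ^ 2` cancels.
  have hgt : ∀ t : ℂ, fundRep g !₂[1, z ^ 2 * t] = z • !₂[1, t] := by
    intro t
    rw [fundRep_suMk]
    ext i
    fin_cases i
    · simp
    · simp at hz1 ⊢
      linear_combination z * t * hz1
  have key : ∀ t : ℂ, B (L.pow m !₂[1, 0]) (L.pow n !₂[1, z ^ 2 * t])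
      = z ^ (m + n) * B (L.pow m !₂[1, 0]) (L.pow n !₂[1, t]) := by
    intro t
    rw [← hB g, rho_pow, rho_pow, hg1, hgt, L.pow_smul, L.pow_smul]
    simp [pow_add]
    ring
  have hpoly : (∑ j ∈ Finset.range (n + 1), Polynomial.C (a j * (z ^ 2) ^ j) * Polynomial.X ^ j)
      = ∑ j ∈ Finset.range (n + 1), Polynomial.C (z ^ (m + n) * a j) * Polynomial.X ^ j := by
    refine Polynomial.funext fun t => ?_
    have := key t
    rw [ha, ha, Finset.mul_sum] at this
    simp only [Polynomial.eval_finsetSum, Polynomial.eval_mul, Polynomial.eval_C,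
      Polynomial.eval_pow, Polynomial.eval_X]
    simpa [mul_pow, mul_assoc] using this
  have hc := congrArg (fun Q : Polynomial ℂ => Q.coeff j) hpoly
  have hj' : j < n + 1 := by omega
  simp only [Polynomial.finsetSum_coeff, Polynomial.coeff_C_mul_X_pow, Finset.sum_ite_eq,
    Finset.mem_range, hj', if_true] at hc
  by_contra h0
  have hpow : z ^ (2 * j) = z ^ (m + n) := by
    rw [pow_mul]
    exact mul_left_cancel₀ h0 (by rw [hc, mul_comm])
  exact hne (hz.pow_inj (by omega) (by omega) hpow)

/-- With `exists_fundRep_eq`, this reduces every pair of powers to one whose first entry is the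
power of `(1, 0)`. -/
theorem IsInvariant.apply_pow {m n : ℕ} {B : L m →ₗ[ℂ] L n →ₗ[ℂ] ℂ} (hB : IsInvariant B)
    (g : SU2) (a : ℂ) (w : C2) :
    B (L.pow m (fundRep g (a • !₂[1, 0]))) (L.pow n (fundRep g w))
      = a ^ m * B (L.pow m !₂[1, 0]) (L.pow n w) := by
  rw [← rho_pow, ← rho_pow, hB, L.pow_smul]
  simp

theorem linearMap₂_ext_pow {m n : ℕ} {B C : L m →ₗ[ℂ] L n →ₗ[ℂ] ℂ}
    (h : ∀ u v, B (L.pow m u) (L.pow n v) = C (L.pow m u) (L.pow n v)) : B = C := by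
  ext x y
  have h1 : ∀ u, B (L.pow m u) - C (L.pow m u) = 0 := fun u =>
    L.linearMap_eq_zero fun v => by simp [h]
  have h2 : (B - C).flip y = 0 := L.linearMap_eq_zero fun u => by
    simpa using LinearMap.congr_fun (h1 u) y
  simpa [sub_eq_zero] using LinearMap.congr_fun h2 x

/-- No `j ≤ n` satisfies `2 * j = m + n` when `n < m`, so no coefficient survives. -/
theorem IsInvariant.eq_zero_of_lt {m n : ℕ} {B : L m →ₗ[ℂ] L n →ₗ[ℂ] ℂ} (hB : IsInvariant B)
    (h : n < m) : B = 0 := by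
  obtain ⟨a, ha0, ha⟩ := hB.exists_coeff
  refine linearMap₂_ext_pow fun u v => ?_
  obtain ⟨g, c, rfl⟩ := exists_fundRep_eq u
  obtain ⟨w, rfl⟩ := (fundRep g).surjective v
  rw [hB.apply_pow, ha, Finset.sum_eq_zero fun j hj => ?_]
  · simp
  · rw [Finset.mem_range] at hj
    rw [ha0 j (by omega) (by omega), zero_mul]

theorem IsInvariant.eq_zero {m n : ℕ} {B : L m →ₗ[ℂ] L n →ₗ[ℂ] ℂ} (hB : IsInvariant B)
    (h : m ≠ n) : B = 0 := by
  rcases lt_or_gt_of_ne h with h | h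
  · have := hB.flip.eq_zero_of_lt h
    ext x y
    exact LinearMap.congr_fun₂ this y x
  · exact hB.eq_zero_of_lt h

theorem IsInvariant.exists_eq_smul {n : ℕ} {B : L n →ₗ[ℂ] L n →ₗ[ℂ] ℂ} (hB : IsInvariant B) :
    ∃ c : ℂ, B = c • symAreaForm n := by
  obtain ⟨a, ha0, ha⟩ := hB.exists_coeff
  -- Only `j = n` survives, and `v 1 ^ n` is the `n`-th power of `area` of `(1, 0)` and `v`.
  refine ⟨a n, linearMap₂_ext_pow fun u v => ?_⟩
  obtain ⟨g, c, rfl⟩ := exists_fundRep_eq u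
  obtain ⟨w, rfl⟩ := (fundRep g).surjective v
  rw [hB.apply_pow, ha, Finset.sum_eq_single n]
  · rw [LinearMap.smul_apply, LinearMap.smul_apply, symAreaForm_pow, area_fundRep]
    simp [area, mul_pow]
    ring
  · intro j hj hne
    rw [Finset.mem_range] at hj
    rw [ha0 j (by omega) (by omega), zero_mul]
  · simp

/-! ### Invariant vectors -/

theorem inner_congrIsometry_right {E F : Type*} [NormedAddCommGroup E] [InnerProductSpace ℂ E]
    [NormedAddCommGroup F] [InnerProductSpace ℂ F] (U : SU2 →* (E ≃ₗᵢ[ℂ] E))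
    (W : SU2 →* (F ≃ₗᵢ[ℂ] F)) (g : SU2) (ξ : E ⊗[ℂ] F) (x : E) (y : F) :
    ⟪TensorProduct.congrIsometry (U g) (W g) ξ, x ⊗ₜ[ℂ] y⟫_ℂ
      = ⟪ξ, U g⁻¹ x ⊗ₜ[ℂ] W g⁻¹ y⟫_ℂ := by
  rw [← (TensorProduct.congrIsometry (U g) (W g)).inner_map_map ξ]
  simp

theorem mem_det_iff {H : Type*} [NormedAddCommGroup H] [InnerProductSpace ℂ H]
    {τ : SU2 →* (H ≃ₗᵢ[ℂ] H)} {ξ : H ⊗[ℂ] H} :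
    ξ ∈ det τ ↔ ∀ g x y, ⟪ξ, τ g x ⊗ₜ[ℂ] τ g y⟫_ℂ = ⟪ξ, x ⊗ₜ[ℂ] y⟫_ℂ := by
  constructor
  · intro h g x y
    conv_rhs => rw [← h g⁻¹, inner_congrIsometry_right, inv_inv]
  · intro h g
    rw [TensorProduct.ext_iff_inner_right]
    intro x y
    rw [inner_congrIsometry_right, h]

/-- The vector in `det (ρ_n, L_n)` that represents `symAreaForm`. -/
theorem exists_mem_det_rho (n : ℕ) :
    ∃ ζ ∈ det (rho n), ∀ x y, ⟪ζ, x ⊗ₜ[ℂ] y⟫_ℂ = symAreaForm n x y := by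
  obtain ⟨ζ, hζ⟩ := exists_eq_inner (TensorProduct.lift (symAreaForm n))
  have h : ∀ x y, ⟪ζ, x ⊗ₜ[ℂ] y⟫_ℂ = symAreaForm n x y := fun x y => by rw [← hζ]; simp
  refine ⟨ζ, mem_det_iff.mpr fun g x y => ?_, h⟩
  rw [h, h, symAreaForm_rho]

/-- A nonzero vector in `det (ρ_n, L_n)`. -/
def singlet (n : ℕ) : L n ⊗[ℂ] L n := (exists_mem_det_rho n).choose

theorem singlet_mem (n : ℕ) : singlet n ∈ det (rho n) := (exists_mem_det_rho n).choose_spec.1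

theorem inner_singlet {n : ℕ} (x y : L n) : ⟪singlet n, x ⊗ₜ[ℂ] y⟫_ℂ = symAreaForm n x y :=
  (exists_mem_det_rho n).choose_spec.2 x y

theorem singlet_ne_zero (n : ℕ) : singlet n ≠ 0 := by
  intro h
  have h1 := inner_singlet (L.pow n !₂[1, 0]) (L.pow n !₂[0, 1])
  rw [h, symAreaForm_pow] at h1
  simp [area] at h1

/-! ### Invariant vectors along the copies of `L_m` in `H`. -/

section Family

variable {H : Type*} [NormedAddCommGroup H] [InnerProductSpace ℂ H]
  {τ : SU2 →* (H ≃ₗᵢ[ℂ] H)} {k : ℕ → ℕ} {V : IsotypicSum k ≃ₗᵢ[ℂ] H}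

/-- The `i`-th copy of `L_m` in `H`. -/
def copy (V : IsotypicSum k ≃ₗᵢ[ℂ] H) (m : ℕ) (i : Fin (k m)) : L m →ₗᵢ[ℂ] H :=
  (summand V m).comp (copiesSingle i)

theorem copy_rho (hV : ∀ (g : SU2) (x : IsotypicSum k), V (isotypicRep k g x) = τ g (V x))
    (m : ℕ) (i : Fin (k m)) (g : SU2) (x : L m) :
    copy V m i (rho m g x) = τ g (copy V m i x) := by
  change V _ = τ g (V _)
  rw [← hV]
  congr 1
  ext l j
  rw [isotypicRep_apply]
  change (lp.single (E := fun m => Copies (Fin (k m)) (L m)) 2 m (PiLp.single 2 i (rho m g x))) l j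
    = rho l g ((lp.single (E := fun m => Copies (Fin (k m)) (L m)) 2 m (PiLp.single 2 i x)) l j)
  by_cases hl : l = m
  · subst hl
    rw [lp.single_apply_self, lp.single_apply_self]
    by_cases hj : j = i
    · subst hj; simp
    · simp [hj]
  · rw [lp.single_apply_ne _ _ _ hl, lp.single_apply_ne _ _ _ hl]
    simp

theorem inner_copy_of_ne {m l : ℕ} (h : m ≠ l) (i : Fin (k m)) (j : Fin (k l)) (x : L m)
    (y : L l) : ⟪copy V m i x, copy V l j y⟫_ℂ = 0 :=
  inner_summand V h _ _

theorem inner_copy_of_ne' {m : ℕ} {i j : Fin (k m)} (h : i ≠ j) (x y : L m) :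
    ⟪copy V m i x, copy V m j y⟫_ℂ = 0 :=
  ((summand V m).inner_map_map _ _).trans (inner_copiesSingle h x y)

/-- Pairing `h` with each of its own components shows that all of them have norm zero. -/
theorem eq_zero_of_inner_copy {h : H} (hh : ∀ m i x, ⟪h, copy V m i x⟫_ℂ = 0) : h = 0 := by
  obtain ⟨y, rfl⟩ := V.surjective h
  have hy : y = 0 := by
    ext m i
    have h1 := hh m i (y m i)
    rw [show copy V m i (y m i) = V (lp.single (E := fun m => Copies (Fin (k m)) (L m)) 2 m
      (PiLp.single 2 i (y m i))) from rfl, V.inner_map_map, lp.inner_single_right,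
      PiLp.inner_apply, Finset.sum_eq_single i (fun j _ hj => by simp [hj]) (by simp)] at h1
    simpa using h1
  rw [hy, map_zero]

/-- The invariant vectors in `H ⊗ H` given by the singlets in pairs of copies of `L_m`. -/
def singletFamily (V : IsotypicSum k ≃ₗᵢ[ℂ] H) (s : Σ m, Fin (k m) × Fin (k m)) : H ⊗[ℂ] H :=
  TensorProduct.mapIsometry (copy V s.1 s.2.1) (copy V s.1 s.2.2) (singlet s.1)

/-- The vectors are nonzero and pairwise orthogonal: distinct indices give orthogonal copies in at
least one tensor factor. -/
theorem linearIndependent_singletFamily (V : IsotypicSum k ≃ₗᵢ[ℂ] H) :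
    LinearIndependent ℂ (singletFamily V) := by
  refine linearIndependent_of_ne_zero_of_inner_eq_zero (𝕜 := ℂ) (fun s h => ?_) ?_
  · refine singlet_ne_zero s.1 ((TensorProduct.mapIsometry (copy V s.1 s.2.1)
      (copy V s.1 s.2.2)).injective ?_)
    rw [map_zero]
    exact h
  · rintro ⟨m, i, j⟩ ⟨l, i', j'⟩ hne
    refine inner_map_map_eq_zero _ _ _ _ ?_ _ _
    by_cases hm : m = l
    · subst hm
      by_cases hi : i = i'
      · subst hi
        exact Or.inr (inner_copy_of_ne' fun hj : j = j' => hne (by rw [hj]))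
      · exact Or.inl (inner_copy_of_ne' hi)
    · exact Or.inl (inner_copy_of_ne hm _ _)

theorem mapIsometry_copy_mem_det
    (hV : ∀ (g : SU2) (x : IsotypicSum k), V (isotypicRep k g x) = τ g (V x))
    {m : ℕ} (i j : Fin (k m)) {ζ : L m ⊗[ℂ] L m} (hζ : ζ ∈ det (rho m)) :
    TensorProduct.mapIsometry (copy V m i) (copy V m j) ζ ∈ det τ := by
  intro g
  have h : ∀ ω : L m ⊗[ℂ] L m, TensorProduct.congrIsometry (τ g) (τ g)
      (TensorProduct.mapIsometry (copy V m i) (copy V m j) ω)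
      = TensorProduct.mapIsometry (copy V m i) (copy V m j)
        (TensorProduct.congrIsometry (rho m g) (rho m g) ω) := by
    intro ω
    induction ω with
    | zero => simp
    | add a b ha hb => simp only [map_add, ha, hb]
    | tmul a b => simp [copy_rho hV]
  rw [h, hζ g]

theorem isInvariant_inner_copy
    (hV : ∀ (g : SU2) (x : IsotypicSum k), V (isotypicRep k g x) = τ g (V x))
    {ξ : H ⊗[ℂ] H} (hξ : ξ ∈ det τ) {m l : ℕ} (i : Fin (k m)) (j : Fin (k l)) :
    IsInvariant (((TensorProduct.mk ℂ H H).compr₂ (innerₛₗ ℂ ξ)).compl₁₂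
      (copy V m i).toLinearMap (copy V l j).toLinearMap) := by
  intro g x y
  simp only [LinearMap.compl₁₂_apply, LinearMap.compr₂_apply, TensorProduct.mk_apply,
    innerₛₗ_apply_apply, LinearIsometry.coe_toLinearMap, copy_rho hV]
  exact mem_det_iff.mp hξ g _ _

variable [FiniteDimensional ℂ H]

theorem span_copy (V : IsotypicSum k ≃ₗᵢ[ℂ] H) :
    Submodule.span ℂ {h : H | ∃ m i x, copy V m i x = h} = ⊤ := by
  rw [← Submodule.orthogonal_eq_bot_iff, Submodule.eq_bot_iff]
  intro h hh
  refine eq_zero_of_inner_copy (V := V) fun m i x => ?_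
  rw [Submodule.mem_orthogonal'] at hh
  exact hh _ (Submodule.subset_span ⟨m, i, x, rfl⟩)

theorem eq_zero_of_inner_copy_tmul {ξ : H ⊗[ℂ] H}
    (h : ∀ m i x l j y, ⟪ξ, copy V m i x ⊗ₜ[ℂ] copy V l j y⟫_ℂ = 0) : ξ = 0 := by
  have hB : (TensorProduct.mk ℂ H H).compr₂ (innerₛₗ ℂ ξ) = 0 := by
    refine LinearMap.ext_on (span_copy V) ?_
    rintro _ ⟨m, i, x, rfl⟩
    refine LinearMap.ext_on (span_copy V) ?_
    rintro _ ⟨l, j, y, rfl⟩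
    simpa using h m i x l j y
  rw [TensorProduct.ext_iff_inner_right]
  intro x y
  simpa using LinearMap.congr_fun₂ hB x y

/-- An invariant vector orthogonal to all singlets vanishes. -/
theorem eq_zero_of_mem_det
    (hV : ∀ (g : SU2) (x : IsotypicSum k), V (isotypicRep k g x) = τ g (V x))
    {ξ : H ⊗[ℂ] H} (hξ : ξ ∈ det τ) (h : ∀ s, ⟪ξ, singletFamily V s⟫_ℂ = 0) : ξ = 0 := by
  refine eq_zero_of_inner_copy_tmul (V := V) fun m i x l j y => ?_
  by_cases hml : m = l
  · subst hml
    obtain ⟨c, hc⟩ := (isInvariant_inner_copy hV hξ i j).exists_eq_smul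
    have hc' : ∀ x y, ⟪ξ, copy V m i x ⊗ₜ[ℂ] copy V m j y⟫_ℂ = c * symAreaForm m x y :=
      fun x y => LinearMap.congr_fun₂ hc x y
    -- On this pair of copies `ξ` acts as `c` times the singlet; evaluation at the singlet itself
    -- then gives `c * ⟪singlet m, singlet m⟫ = 0`.
    have hω : ∀ ω, ⟪ξ, TensorProduct.mapIsometry (copy V m i) (copy V m j) ω⟫_ℂ
        = c * ⟪singlet m, ω⟫_ℂ := by
      intro ω
      induction ω with
      | zero => simp
      | add a b ha hb => simp only [map_add, inner_add_right, ha, hb, mul_add]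
      | tmul a b => rw [inner_singlet, ← hc']; simp
    have h0 := hω (singlet m)
    rw [show ⟪ξ, TensorProduct.mapIsometry (copy V m i) (copy V m j) (singlet m)⟫_ℂ = 0 from
      h ⟨m, i, j⟩] at h0
    have hc0 : c = 0 := by
      rcases mul_eq_zero.mp h0.symm with h | h
      · exact h
      · exact absurd (inner_self_eq_zero.mp h) (singlet_ne_zero m)
    rw [hc', hc0, zero_mul]
  · exact LinearMap.congr_fun₂ ((isInvariant_inner_copy hV hξ i j).eq_zero hml) x y

/-- The part of `det τ` orthogonal to the span is zero by `eq_zero_of_mem_det`. -/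
theorem span_singletFamily
    (hV : ∀ (g : SU2) (x : IsotypicSum k), V (isotypicRep k g x) = τ g (V x)) :
    Submodule.span ℂ (Set.range (singletFamily V)) = det τ := by
  have hle : Submodule.span ℂ (Set.range (singletFamily V)) ≤ det τ := by
    rw [Submodule.span_le]
    rintro _ ⟨s, rfl⟩
    exact mapIsometry_copy_mem_det hV _ _ (singlet_mem _)
  have h := Submodule.sup_orthogonal_inf_of_hasOrthogonalProjection hle
  have hbot : (Submodule.span ℂ (Set.range (singletFamily V)))ᗮ ⊓ det τ = ⊥ := by
    rw [Submodule.eq_bot_iff]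
    rintro ξ ⟨h1, h2⟩
    exact eq_zero_of_mem_det hV h2 fun s =>
      (Submodule.mem_orthogonal' _ _).mp h1 _ (Submodule.subset_span ⟨s, rfl⟩)
  rwa [hbot, sup_bot_eq] at h

theorem hasSum_finrank_det
    (hV : ∀ (g : SU2) (x : IsotypicSum k), V (isotypicRep k g x) = τ g (V x)) :
    HasSum (fun m => k m ^ 2) (Module.finrank ℂ (det τ)) := by
  have hli := linearIndependent_singletFamily V
  have : Finite (Σ m, Fin (k m) × Fin (k m)) := hli.finite
  -- A linearly independent family in the finite-dimensional `H ⊗ H` has a finite index set, which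
  -- forces `k m = 0` for all but finitely many `m`.
  have : Fintype (Σ m, Fin (k m) × Fin (k m)) := Fintype.ofFinite _
  have hs : (Set.range (Sigma.fst : (Σ m, Fin (k m) × Fin (k m)) → ℕ)).Finite :=
    Set.finite_range _
  have hk : ∀ m, m ∉ hs.toFinset → k m ^ 2 = 0 := by
    intro m hm
    by_contra h0
    have hpos : 0 < k m := Nat.pos_of_ne_zero fun h => h0 (by simp [h])
    exact hm (hs.mem_toFinset.mpr ⟨⟨m, ⟨0, hpos⟩, ⟨0, hpos⟩⟩, rfl⟩)
  have hcard : Module.finrank ℂ (det τ) = ∑ m ∈ hs.toFinset, k m ^ 2 := by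
    rw [← span_singletFamily hV, finrank_span_eq_card hli, ← Finset.card_univ,
      show (Finset.univ : Finset (Σ m, Fin (k m) × Fin (k m)))
        = hs.toFinset.sigma fun _ => Finset.univ from ?_, Finset.card_sigma]
    · simp [sq]
    · ext s
      simp
  rw [hcard]
  exact hasSum_sum_of_ne_finset_zero hk

/-! ### The image of `detSum` under the isometry. -/

/-- The isometry `⨁_m (L_m ⊗ L_m)^{⊕ k_m²} → H ⊗ H`. -/
def squareSumIsometry (V : IsotypicSum k ≃ₗᵢ[ℂ] H) : SquareSum k →ₗᵢ[ℂ] H ⊗[ℂ] H :=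
  (iota V).comp (squareSumEquiv k).toLinearIsometry

theorem squareSumIsometry_hasSum (V : IsotypicSum k ≃ₗᵢ[ℂ] H) (x : SquareSum k) :
    HasSum (fun m => ∑ p : Fin (k m) × Fin (k m),
      TensorProduct.mapIsometry (copy V m p.1) (copy V m p.2) (x m p))
      (squareSumIsometry V x) := by
  have h := (orthogonalFamily_summand V).hasSum_linearIsometry (squareSumEquiv k x)
  refine h.congr_fun fun m => Eq.symm ?_
  change TensorProduct.mapIsometry (summand V m) (summand V m)
    (∑ p : Fin (k m) × Fin (k m),
      TensorProduct.mapIsometry (copiesSingle p.1) (copiesSingle p.2) (x m p)) = _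
  rw [map_sum]
  refine Finset.sum_congr rfl fun p _ => ?_
  exact (LinearMap.congr_fun (TensorProduct.map_comp (summand V m).toLinearMap
    (summand V m).toLinearMap (copiesSingle p.1).toLinearMap (copiesSingle p.2).toLinearMap)
    (x m p)).symm

theorem map_detSum
    (hV : ∀ (g : SU2) (x : IsotypicSum k), V (isotypicRep k g x) = τ g (V x)) :
    (detSum k).map (squareSumIsometry V).toLinearMap = det τ := by
  apply le_antisymm
  · rintro _ ⟨x, hx, rfl⟩
    -- The image is a limit of finite sums of invariant vectors, and `det τ` is closed.
    exact (det τ).closed_of_finiteDimensional.mem_of_tendsto (squareSumIsometry_hasSum V x)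
      (Filter.Eventually.of_forall fun s => (det τ).sum_mem fun m _ => (det τ).sum_mem fun p _ =>
        mapIsometry_copy_mem_det hV _ _ (hx m p))
  · rw [← span_singletFamily hV, Submodule.span_le]
    rintro _ ⟨⟨m, p⟩, rfl⟩
    -- A singlet in the single summand `(m, p)` is a preimage of the corresponding member of
    -- `singletFamily`.
    let x : SquareSum k := lp.single 2 m (PiLp.single 2 p (singlet m))
    have hx : ∀ l q, l ≠ m → x l q = 0 := fun l q hl => by
      simp only [x, lp.single_apply_ne _ _ _ hl]
      rfl
    have hxm : ∀ q, x m q = if q = p then singlet m else 0 := fun q => by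
      simp [x]
    refine ⟨x, fun l q => ?_, ?_⟩
    · by_cases hl : l = m
      · subst hl
        rw [hxm]
        split_ifs
        exacts [singlet_mem _, zero_mem _]
      · rw [hx l q hl]
        exact zero_mem _
    · refine (squareSumIsometry_hasSum V x).unique ?_
      convert hasSum_single m fun l hl => ?_ using 1
      · rw [Finset.sum_eq_single p (fun q _ hq => by rw [hxm, if_neg hq, map_zero]) (by simp), hxm,
          if_pos rfl]
        rfl
      · exact Finset.sum_eq_zero fun q _ => by rw [hx l q hl, map_zero]

end Family

end SU2Det

end

theorem propositionp {H : Type*} [NormedAddCommGroup H] [InnerProductSpace ℂ H]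
    [FiniteDimensional ℂ H]
    (τ : SU2Det.SU2 →* (H ≃ₗᵢ[ℂ] H)) (hτ : ∀ x : H, Continuous fun g => τ g x)
    (k : ℕ → ℕ) (V : SU2Det.IsotypicSum k ≃ₗᵢ[ℂ] H)
    (hV : ∀ (g : SU2Det.SU2) (x : SU2Det.IsotypicSum k),
      V (SU2Det.isotypicRep k g x) = τ g (V x)) :
    HasSum (fun m => k m ^ 2) (Module.finrank ℂ (SU2Det.det τ)) ∧
    ∃ U : SU2Det.detSum k ≃ₗᵢ[ℂ] SU2Det.det τ,
      ∀ x : SU2Det.detSum k,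
        (U x : H ⊗[ℂ] H) = SU2Det.iota V (SU2Det.squareSumEquiv k (x : SU2Det.SquareSum k)) := by
  refine ⟨SU2Det.hasSum_finrank_det hV, ?_⟩
  let T := SU2Det.squareSumIsometry V
  let e : SU2Det.detSum k ≃ₗ[ℂ] SU2Det.det τ :=
    (Submodule.equivMapOfInjective T.toLinearMap T.injective (SU2Det.detSum k)).trans
      (LinearEquiv.ofEq _ _ (SU2Det.map_detSum hV))
  exact ⟨⟨e, fun x => T.norm_map x⟩, fun x => rfl⟩
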